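/- Let $d,n\ge 1$ be integers. For $m\ge 1$ and a unit vector $|\phi\rangle\in\mathbb{C}^d\otimes\mathbb{C}^m$ the G-concurrence is $G(|\phi\rangle)=\big(\det\phi^{A}\big)^{1/d}$, where $\phi^{A}=\mathrm{Tr}_2|\phi\rangle\langle\phi|$ is the reduced matrix on the first factor $\mathbb{C}^d$; for $m=d$ this is $|\det X|^{2/d}$ with $|\phi\rangle=(X\otimes I)\sum_i|i\rangle|i\rangle$. For a density matrix $\rho$ on $\mathbb{C}^d\otimes\mathbb{C}^m$, $G(\rho)$ is the convex roof, that is, the infimum of $\sum_j p_jG(|\phi_j\rangle)$ over all finite decompositions $\rho=\sum_j p_j|\phi_j\rangle\langle\phi_j|$ with unit vectors $|\phi_j\rangle$, $p_j\ge 0$ and $\sum_jp_j=1$. For a state on $\mathbb{C}^d\otimes\mathbb{C}^d\otimes\mathbb{C}^n$ with parties $A,B,C$, the label $A|BC$ means that $G$ is taken for the bipartition $\mathbb{C}^d\otimes(\mathbb{C}^d\otimes\mathbb{C}^n)$, and $\rho^{AB},\rho^{AC}$ denote the reduced density matrices. (1) Let $|\psi\rangle\in\mathbb{C}^d\otimes\mathbb{C}^d\otimes\mathbb{C}^n$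 be a unit vector with marginal $\rho^{AB}=\mathrm{Tr}_C|\psi\rangle\langle\psi|$. If $G(\psi^{A|BC})=G(\rho^{AB})>0$, then $|\psi\rangle=|\chi\rangle^{AB}|\varphi\rangle^{C}$ for some unit vectors $|\chi\rangle\in\mathbb{C}^d\otimes\mathbb{C}^d$ and $|\varphi\rangle\in\mathbb{C}^n$. (2) Let $d\ge 2$. The G-concurrence is monogamous on pure tripartite states: for every unit vector $|\psi\rangle\in\mathbb{C}^d\otimes\mathbb{C}^d\otimes\mathbb{C}^n$ with marginals $\rho^{AB}$ and $\rho^{AC}$, if $G(\psi^{A|BC})=G(\rho^{AB})$, then $G(\rho^{AC})=0$. (3) Let $d\ge 2$. The G-concurrence is monogamous on all tripartite states: for every density matrix $\rho^{ABC}$ on $\mathbb{C}^d\otimes\mathbb{C}^d\otimes\mathbb{C}^n$, if $G(\rho^{A|BC})=G(\rho^{AB})$, then $G(\rho^{AC})=0$. -/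

import Mathlib

open scoped ComplexOrder

noncomputable section

namespace Quantum

variable {ι α β γ : Type*} [Fintype ι] [Fintype α] [Fintype β] [Fintype γ]

/-- `ρ` is a density matrix on `ℂ^ι`: positive semidefinite of trace one. -/
def IsDensity (ρ : Matrix ι ι ℂ) : Prop :=
  ρ.PosSemidef ∧ ρ.trace = 1

/-- The matrix `|ψ⟩⟨ψ|` of a vector `ψ ∈ ℂ^ι`. -/
def ketBra (ψ : EuclideanSpace ℂ ι) : Matrix ι ι ℂ :=
  Matrix.of fun i j => ψ i * star (ψ j)

/-- The reduced matrix `ρ^A = Tr_B ρ` of a matrix on `ℂ^α ⊗ ℂ^β`. -/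
def marginalA (ρ : Matrix (α × β) (α × β) ℂ) : Matrix α α ℂ :=
  Matrix.of fun a a' => ∑ b, ρ (a, b) (a', b)

/-- The reduced matrix `ρ^{AB} = Tr_C ρ` of a matrix on `ℂ^α ⊗ ℂ^β ⊗ ℂ^γ`. -/
def marginalAB (ρ : Matrix (α × β × γ) (α × β × γ) ℂ) : Matrix (α × β) (α × β) ℂ :=
  Matrix.of fun x y => ∑ c, ρ (x.1, x.2, c) (y.1, y.2, c)

/-- The reduced matrix `ρ^{AC} = Tr_B ρ` of a matrix on `ℂ^α ⊗ ℂ^β ⊗ ℂ^γ`. -/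
def marginalAC (ρ : Matrix (α × β × γ) (α × β × γ) ℂ) : Matrix (α × γ) (α × γ) ℂ :=
  Matrix.of fun x y => ∑ b, ρ (x.1, b, x.2) (y.1, b, y.2)

/-- The G-concurrence `(det ρ^A)^{1/d_A}` of a vector in `ℂ^α ⊗ ℂ^β`, where `ρ^A` is the reduced
matrix of `|ψ⟩⟨ψ|` (its determinant is a nonnegative real number) and `d_A = dim ℂ^α`.
A tripartite vector, with index type `α × β × γ = α × (β × γ)`, is measured in the split `A|BC`. -/
def gPure [DecidableEq α] (ψ : EuclideanSpace ℂ (α × β)) : ℝ :=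
  ((marginalA (ketBra ψ)).det.re) ^ (1 / (Fintype.card α : ℝ))

/-- On `ℂ^α ⊗ ℂ^α` the G-concurrence is `|det X|^{2/d}`, where `|ψ⟩ = (X ⊗ I) ∑ i, |i⟩|i⟩`. -/
theorem gPure_eq_norm_det [DecidableEq α] (ψ : EuclideanSpace ℂ (α × α)) :
    gPure ψ = ‖(Matrix.of fun i j => ψ (i, j) : Matrix α α ℂ).det‖ ^
      (2 / (Fintype.card α : ℝ)) := by
  set X : Matrix α α ℂ := Matrix.of fun i j => ψ (i, j) with hX
  have h : marginalA (ketBra ψ) = X * X.conjTranspose := by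
    ext a a'
    simp [marginalA, ketBra, hX, Matrix.mul_apply]
  have h2 : (X.det * star X.det).re = ‖X.det‖ ^ (2 : ℝ) := by
    rw [← starRingEnd_apply, Complex.mul_conj]
    rw [Complex.ofReal_re, Complex.normSq_eq_norm_sq, Real.rpow_two]
  rw [gPure, h, Matrix.det_mul, Matrix.det_conjTranspose, h2, ← Real.rpow_mul (norm_nonneg _)]
  congr 1
  ring

/-- `ρ = ∑ j, p j |ψ j⟩⟨ψ j|` with a finite probability distribution `p` and unit vectors `ψ j`. -/
def IsPureDecomposition (ρ : Matrix ι ι ℂ) (k : ℕ) (p : Fin k → ℝ)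
    (ψ : Fin k → EuclideanSpace ℂ ι) : Prop :=
  (∀ j, 0 ≤ p j) ∧ ∑ j, p j = 1 ∧ (∀ j, ‖ψ j‖ = 1) ∧ ρ = ∑ j, (p j : ℂ) • ketBra (ψ j)

/-- The average G-concurrences of all pure state decompositions of `ρ`. -/
def gAverages [DecidableEq α] (ρ : Matrix (α × β) (α × β) ℂ) : Set ℝ :=
  {x | ∃ (k : ℕ) (p : Fin k → ℝ) (ψ : Fin k → EuclideanSpace ℂ (α × β)),
    IsPureDecomposition ρ k p ψ ∧ x = ∑ j, p j * gPure (ψ j)}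

/-- The G-concurrence of a density matrix on `ℂ^α ⊗ ℂ^β`: the convex roof of `gPure`. -/
def gConc [DecidableEq α] (ρ : Matrix (α × β) (α × β) ℂ) : ℝ :=
  sInf (gAverages ρ)

/-- Every density matrix has a pure state decomposition, so the infimum in `gConc` is over a
nonempty set of nonnegative numbers. -/
theorem gAverages_nonempty [DecidableEq α] [DecidableEq β]
    {ρ : Matrix (α × β) (α × β) ℂ} (h : IsDensity ρ) : (gAverages ρ).Nonempty := by
  obtain ⟨hp, ht⟩ := h
  have hH := hp.isHermitian
  let e := Fintype.equivFin (α × β)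
  refine ⟨_, Fintype.card (α × β), fun j => hH.eigenvalues (e.symm j),
    fun j => hH.eigenvectorBasis (e.symm j), ⟨fun j => hp.eigenvalues_nonneg _, ?_, ?_, ?_⟩, rfl⟩
  · rw [Equiv.sum_comp e.symm hH.eigenvalues]
    have := hH.trace_eq_sum_eigenvalues
    rw [ht] at this
    apply Complex.ofReal_injective
    rw [Complex.ofReal_sum, Complex.ofReal_one]
    exact this.symm
  · intro j
    exact hH.eigenvectorBasis.orthonormal.1 _
  · rw [Equiv.sum_comp e.symm
      (fun i => ((hH.eigenvalues i : ℝ) : ℂ) • ketBra (hH.eigenvectorBasis i))]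
    have := hH.spectral_theorem
    ext x y
    rw [congrFun (congrFun this x) y]
    simp only [Unitary.conjStarAlgAut_apply, Matrix.mul_apply, Matrix.diagonal_apply,
      Matrix.star_apply, Matrix.sum_apply, Matrix.smul_apply, ketBra, Matrix.of_apply,
      Matrix.IsHermitian.eigenvectorUnitary_apply, smul_eq_mul]
    refine Finset.sum_congr rfl fun i _ => ?_
    simp
    ring

/-- The expectation of `|φ⟩⟨φ|` in the vector `v` is `|⟨v, φ⟩|²`. -/
theorem star_dotProduct_ketBra (v φ : EuclideanSpace ℂ ι) :
    ∑ i, ∑ j, star (v i) * ketBra φ i j * v j = ((‖inner ℂ v φ‖ ^ 2 : ℝ) : ℂ) := by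
  rw [← Complex.normSq_eq_norm_sq, ← Complex.mul_conj, PiLp.inner_apply, map_sum,
    Finset.sum_mul_sum]
  refine Finset.sum_congr rfl fun i _ => Finset.sum_congr rfl fun j _ => ?_
  simp [ketBra]
  ring

/-- On a pure state, the convex roof is the G-concurrence of the state vector. -/
theorem gConc_ketBra [DecidableEq α] (ψ : EuclideanSpace ℂ (α × β)) (hψ : ‖ψ‖ = 1) :
    gConc (ketBra ψ) = gPure ψ := by
  have key : gAverages (ketBra ψ) = {gPure ψ} := by
    apply Set.eq_singleton_iff_unique_mem.2
    refine ⟨⟨1, fun _ => 1, fun _ => ψ, ⟨by simp, by simp, by simp [hψ], by simp⟩, by simp⟩, ?_⟩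
    rintro x ⟨k, p, φ, ⟨hp, hs, hφ, hd⟩, rfl⟩
    have hj : ∀ j, p j * gPure (φ j) = p j * gPure ψ := by
      intro j
      rcases eq_or_ne (p j) 0 with h0 | h0
      · simp [h0]
      set c : ℂ := inner ℂ ψ (φ j) with hc
      set v := φ j - c • ψ with hv
      have hvψ : inner ℂ v ψ = 0 := by
        rw [hv, inner_sub_left, inner_smul_left, hc, inner_self_eq_norm_sq_to_K, hψ]
        simp
      have hvφ : inner ℂ v (φ j) = inner ℂ v v := by
        conv_rhs => rw [hv, inner_sub_right, inner_smul_right, ← hv, hvψ]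
        simp
      have h1 := star_dotProduct_ketBra v ψ
      have h2 : ∑ a, ∑ b, star (v a) * ketBra ψ a b * v b
          = ((∑ i, p i * ‖inner ℂ v (φ i)‖ ^ 2 : ℝ) : ℂ) := by
        rw [hd]
        push_cast
        simp_rw [Matrix.sum_apply, Finset.mul_sum, Finset.sum_mul]
        calc _ = ∑ i, ∑ a, ∑ b, star (v a) * ((p i : ℂ) • ketBra (φ i)) a b * v b := by
              rw [Finset.sum_comm]
              refine Eq.trans ?_ Finset.sum_comm
              rw [Finset.sum_comm]
              exact Finset.sum_congr rfl fun a _ => Finset.sum_comm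
          _ = _ := by
              refine Finset.sum_congr rfl fun i _ => ?_
              have := star_dotProduct_ketBra v (φ i)
              push_cast at this
              rw [← this, Finset.mul_sum]
              refine Finset.sum_congr rfl fun a _ => ?_
              rw [Finset.mul_sum]
              refine Finset.sum_congr rfl fun b _ => ?_
              simp
              ring
      rw [h1, hvψ] at h2
      have h3 : ∑ i, p i * ‖inner ℂ v (φ i)‖ ^ 2 = 0 := by
        have := Complex.ofReal_injective h2
        simpa using this.symm
      have h4 := (Finset.sum_eq_zero_iff_of_nonneg
        (fun i _ => mul_nonneg (hp i) (sq_nonneg _))).1 h3 j (Finset.mem_univ _)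
      have h5 : v = 0 := by
        rw [hvφ] at h4
        simpa [h0] using h4
      have h6 : φ j = c • ψ := sub_eq_zero.1 h5
      have h7 : ‖c‖ = 1 := by
        have := hφ j
        rwa [h6, norm_smul, hψ, mul_one] at this
      have h8 : ketBra (φ j) = ketBra ψ := by
        have h9 : c * star c = 1 := by
          rw [← starRingEnd_apply, Complex.mul_conj, Complex.normSq_eq_norm_sq, h7]
          simp
        ext a b
        rw [h6]
        simp only [ketBra, Matrix.of_apply, PiLp.smul_apply, smul_eq_mul, star_mul']
        linear_combination (ψ a * star (ψ b)) * h9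
      rw [gPure, h8, ← gPure]
    rw [Finset.sum_congr rfl fun j _ => hj j, ← Finset.sum_mul, hs, one_mul]
  rw [gConc, key, csInf_singleton]

end Quantum

end

/-! Measuring C in an orthonormal basis splits `ρ^{AB}` into pure states, the slices of `ψ`, whose
reduced matrices add up to that of `ψ`. Since `det ^ (1 / d)` is superadditive (Minkowski,
`sum_det_rpow_le`), `G(ρ^{AB}) ≤ ∑ G(slice) ≤ G(ψ)`.

If the ends agree and are positive, strictness (`sum_det_rpow_lt`) forbids nonzero singular slices,
and this in every basis (`sliceC_eq_zero_of_det_eq_zero`). A and B have equal dimension, so slices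
are square matrices. A pencil `X - tY` with `Y` nonsingular has a singular member over `ℂ`, which
must then vanish: all slices are proportional and `ψ` is a product. Slicing such a `ψ` along B
leaves product vectors, singular for `d ≥ 2`, so `G(ρ^{AC}) = 0`. If the ends are zero, then
`G(ρ^{AC}) ≤ G(ψ) = 0`.

For mixed states, an optimal decomposition exists by compactness; convexity of the roof forces the
pure-state equality on each term of positive weight, and gives `G(ρ^{AC}) = 0` by averaging. -/

/-! ### Compactness of convex hulls -/

/-- In a finite-dimensional space, the convex hull of a compact set is compact. -/
theorem isCompact_convexHull_of_finiteDimensional {E : Type*} [AddCommGroup E] [Module ℝ E]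
    [TopologicalSpace E] [ContinuousAdd E] [ContinuousSMul ℝ E] [FiniteDimensional ℝ E]
    {s : Set E} (hs : IsCompact s) : IsCompact (convexHull ℝ s) := by
  rcases s.eq_empty_or_nonempty with rfl | ⟨x₀, hx₀⟩
  · simp
  set N := Module.finrank ℝ E + 1
  have hcomp : IsCompact (stdSimplex ℝ (Fin N) ×ˢ Set.univ.pi fun _ : Fin N => s) :=
    (isCompact_stdSimplex ℝ (Fin N)).prod (isCompact_univ_pi fun _ => hs)
  have hcont : Continuous fun q : (Fin N → ℝ) × (Fin N → E) => ∑ i, q.1 i • q.2 i := by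
    fun_prop
  convert hcomp.image hcont
  ext x
  constructor
  · intro hx
    -- Carathéodory: affinely independent points number at most `N`. The missing indices are filled
    -- with weight `0` at `x₀`.
    obtain ⟨ι, _, z, w, hz, hind, hw, hw1, rfl⟩ := eq_pos_convex_span_of_mem_convexHull hx
    obtain ⟨f⟩ : Nonempty (ι ↪ Fin N) := by
      apply Function.Embedding.nonempty_of_card_le
      rw [Fintype.card_fin]
      exact hind.card_le_finrank_succ.trans
        (Nat.succ_le_succ (Submodule.finrank_le _))
    have hoff : ∀ j, j ∉ Set.range f → Function.extend f w 0 j = 0 := fun j hj => by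
      rw [Function.extend_apply' _ _ _ hj]; rfl
    refine ⟨(Function.extend f w 0, Function.extend f z fun _ => x₀), ⟨⟨fun j => ?_, ?_⟩, ?_⟩, ?_⟩
    · change 0 ≤ Function.extend f w 0 j
      by_cases hj : j ∈ Set.range f
      · obtain ⟨i, rfl⟩ := hj
        rw [f.injective.extend_apply]
        exact (hw i).le
      · rw [hoff j hj]
    · rw [← hw1]
      exact (Fintype.sum_of_injective f f.injective _ _ hoff
        fun i => (f.injective.extend_apply _ _ _).symm).symm
    · intro j _
      by_cases hj : j ∈ Set.range f
      · obtain ⟨i, rfl⟩ := hj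
        simp only [f.injective.extend_apply]
        exact hz ⟨i, rfl⟩
      · simp only [Function.extend_apply' _ _ _ hj]
        exact hx₀
    · refine (Fintype.sum_of_injective f f.injective _ _ (fun j hj => ?_) fun i => ?_).symm
      · simp only [hoff j hj, zero_smul]
      · simp only [f.injective.extend_apply]
  · rintro ⟨⟨w, z⟩, ⟨⟨hw, hw1⟩, hz⟩, rfl⟩
    exact mem_convexHull_of_exists_fintype w z hw hw1 (fun i => hz i trivial) rfl

/-! ### Determinant inequalities for positive semidefinite matrices -/

namespace Matrix

variable {α : Type*} [Fintype α] [DecidableEq α]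

/-- The arithmetic-geometric mean inequality for the eigenvalues of a positive semidefinite
matrix. -/
theorem PosSemidef.det_rpow_le_trace_div [Nonempty α] {N : Matrix α α ℂ} (hN : N.PosSemidef) :
    N.det.re ^ (1 / (Fintype.card α : ℝ)) ≤ N.trace.re / Fintype.card α := by
  have hd : (0 : ℝ) < Fintype.card α := by exact_mod_cast Fintype.card_pos
  have hdet : N.det.re = ∏ i, hN.isHermitian.eigenvalues i := by
    rw [hN.isHermitian.det_eq_prod_eigenvalues]
    norm_cast
  have htr : N.trace.re = ∑ i, hN.isHermitian.eigenvalues i := by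
    rw [hN.isHermitian.trace_eq_sum_eigenvalues]
    norm_cast
  have := Real.geom_mean_le_arith_mean Finset.univ (fun _ => 1) hN.isHermitian.eigenvalues
    (by simp) (by simpa using Fintype.card_pos) fun i _ => hN.eigenvalues_nonneg i
  simpa [hdet, htr] using this

theorem PosSemidef.ofReal_det_re {N : Matrix α α ℂ} (hN : N.PosSemidef) :
    (N.det.re : ℂ) = N.det :=
  ((Complex.nonneg_iff.1 hN.det_nonneg).2 ▸ rfl : N.det = ⟨N.det.re, 0⟩).symm

theorem PosDef.det_re_pos {A : Matrix α α ℂ} (hA : A.PosDef) : 0 < A.det.re :=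
  (Complex.pos_iff.1 hA.det_pos).1

theorem PosSemidef.det_re_nonneg {A : Matrix α α ℂ} (hA : A.PosSemidef) : 0 ≤ A.det.re :=
  (Complex.nonneg_iff.1 hA.det_nonneg).1

/-- The congruence `M ↦ B * M * Bᴴ` sends `A` to the identity, which reduces statements about `A⁻¹ *
M` to a positive semidefinite matrix with the same trace. -/
theorem PosDef.exists_conjTranspose_mul_self_eq_inv {A : Matrix α α ℂ} (hA : A.PosDef) :
    ∃ B : Matrix α α ℂ, IsUnit B ∧ A⁻¹ = Bᴴ * B := by
  open scoped MatrixOrder in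
  obtain ⟨B, hB⟩ := CStarAlgebra.nonneg_iff_eq_star_mul_self.1 hA.inv.posSemidef.nonneg
  exact ⟨B, isUnit_of_mul_isUnit_right (x := star B) (hB ▸ hA.inv.isUnit), hB⟩

/-- The tangent plane of the concave function `det ^ (1 / d)` at a positive definite matrix lies
above its graph. -/
theorem PosDef.det_rpow_le [Nonempty α] {A M : Matrix α α ℂ} (hA : A.PosDef)
    (hM : M.PosSemidef) :
    M.det.re ^ (1 / (Fintype.card α : ℝ)) ≤
      A.det.re ^ (1 / (Fintype.card α : ℝ)) * ((A⁻¹ * M).trace.re / Fintype.card α) := by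
  obtain ⟨B, -, hB⟩ := hA.exists_conjTranspose_mul_self_eq_inv
  have hN := hM.mul_mul_conjTranspose_same B
  have htr : (B * M * Bᴴ).trace = (A⁻¹ * M).trace := by
    rw [hB, trace_mul_comm, Matrix.mul_assoc]
  have hdet : A.det.re * (B * M * Bᴴ).det.re = M.det.re := by
    have h : A.det * (B * M * Bᴴ).det = M.det := by
      have h1 : A.det * (Bᴴ * B).det = 1 := by
        rw [← hB, ← det_mul, mul_nonsing_inv _ hA.det_pos.ne'.isUnit, det_one]
      rw [det_mul] at h1
      rw [det_mul, det_mul]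
      linear_combination M.det * h1
    rw [← hA.posSemidef.ofReal_det_re, ← hM.ofReal_det_re, ← hN.ofReal_det_re] at h
    exact_mod_cast h
  rw [← hdet, Real.mul_rpow hA.det_re_pos.le hN.det_re_nonneg, ← htr]
  gcongr
  · exact Real.rpow_nonneg hA.det_re_pos.le _
  · exact hN.det_rpow_le_trace_div

/-- Source of strictness: at a nonzero singular `M` the tangent bound is positive while the
determinant is zero. -/
theorem PosDef.trace_inv_mul_pos {A M : Matrix α α ℂ} (hA : A.PosDef) (hM : M.PosSemidef)
    (h0 : M ≠ 0) : 0 < (A⁻¹ * M).trace.re := by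
  obtain ⟨B, hBu, hB⟩ := hA.exists_conjTranspose_mul_self_eq_inv
  have hN := hM.mul_mul_conjTranspose_same B
  have htr : (B * M * Bᴴ).trace = (A⁻¹ * M).trace := by
    rw [hB, trace_mul_comm, Matrix.mul_assoc]
  rw [← htr]
  refine (Complex.pos_iff.1 (lt_of_le_of_ne hN.trace_nonneg fun h => h0 ?_)).1
  have h1 := hN.trace_eq_zero_iff.1 h.symm
  have hBs : IsUnit Bᴴ := hBu.star
  rwa [hBs.mul_left_eq_zero, hBu.mul_right_eq_zero] at h1

variable {κ : Type*} [Fintype κ]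

/-- **Minkowski's determinant inequality** for finite sums. -/
theorem sum_det_rpow_le [Nonempty α] {M : κ → Matrix α α ℂ} (hM : ∀ k, (M k).PosSemidef) :
    ∑ k, (M k).det.re ^ (1 / (Fintype.card α : ℝ)) ≤
      (∑ k, M k).det.re ^ (1 / (Fintype.card α : ℝ)) := by
  have hd : (0 : ℝ) < Fintype.card α := by exact_mod_cast Fintype.card_pos
  have hA : (∑ k, M k).PosSemidef := posSemidef_sum _ fun k _ => hM k
  by_cases h0 : (∑ k, M k).det = 0
  · have hk : ∀ k, (M k).det = 0 := by
      intro k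
      -- A kernel vector of the sum is in every kernel, because the quadratic forms are nonnegative.
      obtain ⟨x, hx, hx0⟩ := exists_mulVec_eq_zero_iff.2 h0
      refine exists_mulVec_eq_zero_iff.1 ⟨x, hx, ((hM k).dotProduct_mulVec_zero_iff x).1 ?_⟩
      have h1 : ∑ k, star x ⬝ᵥ (M k *ᵥ x) = 0 := by
        rw [← dotProduct_sum, ← sum_mulVec, hx0, dotProduct_zero]
      exact (Finset.sum_eq_zero_iff_of_nonneg fun k _ =>
        (hM k).dotProduct_mulVec_nonneg x).1 h1 k (Finset.mem_univ _)
    simp [hk, h0, hd.ne']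
  · have hP := hA.posDef_iff_det_ne_zero.2 h0
    -- All tangent planes are taken at the sum `A`, so the bounds add up to the trace of `A⁻¹ * A`
    -- over `d`, which is `1`.
    refine (Finset.sum_le_sum fun k _ => hP.det_rpow_le (hM k)).trans_eq ?_
    rw [← Finset.mul_sum, ← Finset.sum_div, ← Complex.re_sum, ← trace_sum, ← Matrix.mul_sum,
      nonsing_inv_mul _ (isUnit_iff_ne_zero.2 h0), trace_one]
    simp [hd.ne']

/-- Minkowski's determinant inequality is strict if the sum is nonsingular and one of the summands
is singular and nonzero. -/
theorem sum_det_rpow_lt [Nonempty α] {M : κ → Matrix α α ℂ} (hM : ∀ k, (M k).PosSemidef)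
    (h0 : (∑ k, M k).det ≠ 0) {k₀ : κ} (hk : M k₀ ≠ 0) (hdet : (M k₀).det = 0) :
    ∑ k, (M k).det.re ^ (1 / (Fintype.card α : ℝ)) <
      (∑ k, M k).det.re ^ (1 / (Fintype.card α : ℝ)) := by
  have hd : (0 : ℝ) < Fintype.card α := by exact_mod_cast Fintype.card_pos
  have hP := (posSemidef_sum _ fun k _ => hM k).posDef_iff_det_ne_zero.2 h0
  refine (Finset.sum_lt_sum (fun k _ => hP.det_rpow_le (hM k))
    ⟨k₀, Finset.mem_univ _, ?_⟩).trans_eq ?_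
  · have := hP.trace_inv_mul_pos (hM k₀) hk
    have := Real.rpow_pos_of_pos hP.det_re_pos (1 / (Fintype.card α : ℝ))
    rw [hdet, Complex.zero_re, Real.zero_rpow (by positivity)]
    positivity
  · rw [← Finset.mul_sum, ← Finset.sum_div, ← Complex.re_sum, ← trace_sum, ← Matrix.mul_sum,
      nonsing_inv_mul _ (isUnit_iff_ne_zero.2 h0), trace_one]
    simp [hd.ne']

end Matrix

/-! ### Reduced matrices and slices -/

namespace Quantum

variable {ι α β γ κ : Type*}

theorem ketBra_smul (c : ℂ) (v : EuclideanSpace ℂ ι) :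
    ketBra (c • v) = (‖c‖ ^ 2 : ℝ) • ketBra v := by
  ext i j
  have h : c * star c = (‖c‖ ^ 2 : ℝ) := by
    rw [← starRingEnd_apply, Complex.mul_conj, Complex.normSq_eq_norm_sq]
  simp only [ketBra, Matrix.of_apply, PiLp.smul_apply, smul_eq_mul, star_mul', Matrix.smul_apply,
    Complex.real_smul, ← h]
  ring

theorem posSemidef_ketBra [Fintype ι] (v : EuclideanSpace ℂ ι) : (ketBra v).PosSemidef :=
  Matrix.posSemidef_vecMulVec_self_star v.ofLp

theorem trace_ketBra [Fintype ι] (v : EuclideanSpace ℂ ι) : (ketBra v).trace = (‖v‖ ^ 2 : ℝ) := by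
  rw [EuclideanSpace.norm_sq_eq]
  push_cast
  refine Finset.sum_congr rfl fun i _ => ?_
  simp only [Matrix.diag, ketBra, Matrix.of_apply]
  rw [← starRingEnd_apply, Complex.mul_conj, Complex.normSq_eq_norm_sq]
  push_cast
  rfl

theorem continuous_ketBra : Continuous (ketBra : EuclideanSpace ℂ ι → Matrix ι ι ℂ) := by
  unfold ketBra
  fun_prop

theorem marginalA_sum [Fintype β] [Fintype κ] (ρ : κ → Matrix (α × β) (α × β) ℂ) :
    marginalA (∑ k, ρ k) = ∑ k, marginalA (ρ k) := by
  ext a a'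
  simp only [marginalA, Matrix.of_apply, Matrix.sum_apply]
  exact Finset.sum_comm

theorem marginalA_smul [Fintype β] (r : ℝ) (ρ : Matrix (α × β) (α × β) ℂ) :
    marginalA (r • ρ) = r • marginalA ρ := by
  ext a a'
  simp [marginalA, Finset.mul_sum]

theorem marginalAB_sum_smul [Fintype γ] [Fintype κ] (r : κ → ℝ) (ρ : κ → Matrix (α × β × γ) (α × β × γ) ℂ) :
    marginalAB (∑ k, r k • ρ k) = ∑ k, r k • marginalAB (ρ k) := by
  ext x y
  simp only [marginalAB, Matrix.of_apply, Matrix.sum_apply, Matrix.smul_apply, Finset.smul_sum]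
  exact Finset.sum_comm

theorem marginalAC_sum_smul [Fintype β] [Fintype κ] (r : κ → ℝ) (ρ : κ → Matrix (α × β × γ) (α × β × γ) ℂ) :
    marginalAC (∑ k, r k • ρ k) = ∑ k, r k • marginalAC (ρ k) := by
  ext x y
  simp only [marginalAC, Matrix.of_apply, Matrix.sum_apply, Matrix.smul_apply, Finset.smul_sum]
  exact Finset.sum_comm

theorem trace_marginalA [Fintype α] [Fintype β] (ρ : Matrix (α × β) (α × β) ℂ) : (marginalA ρ).trace = ρ.trace := by
  simp [Matrix.trace, marginalA, Fintype.sum_prod_type]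

theorem marginalA_marginalAB [Fintype β] [Fintype γ] (ρ : Matrix (α × β × γ) (α × β × γ) ℂ) :
    marginalA (marginalAB ρ) = marginalA ρ := by
  ext a a'
  simp [marginalA, marginalAB, Fintype.sum_prod_type]

theorem marginalA_marginalAC [Fintype β] [Fintype γ] (ρ : Matrix (α × β × γ) (α × β × γ) ℂ) :
    marginalA (marginalAC ρ) = marginalA ρ := by
  ext a a'
  simp only [marginalA, marginalAC, Matrix.of_apply, Fintype.sum_prod_type]
  exact Finset.sum_comm

theorem posSemidef_marginalA_ketBra [Fintype α] [Fintype β] (v : EuclideanSpace ℂ (α × β)) :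
    (marginalA (ketBra v)).PosSemidef := by
  have h : marginalA (ketBra v) = (Matrix.of fun a b => v (a, b) : Matrix α β ℂ) *
      (Matrix.of fun a b => v (a, b) : Matrix α β ℂ).conjTranspose := by
    ext a a'
    simp [marginalA, ketBra, Matrix.mul_apply]
  exact h ▸ Matrix.posSemidef_self_mul_conjTranspose _

/-- The vector `(I ⊗ ⟨e|) ψ ∈ ℂ^α ⊗ ℂ^β`, for `ψ ∈ ℂ^α ⊗ ℂ^β ⊗ ℂ^γ` and `e ∈ ℂ^γ`. -/
def sliceC [Fintype γ] (e : EuclideanSpace ℂ γ) (ψ : EuclideanSpace ℂ (α × β × γ)) :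
    EuclideanSpace ℂ (α × β) :=
  WithLp.toLp 2 fun x => ∑ c, star (e c) * ψ (x.1, x.2, c)

/-- The vector `(I ⊗ ⟨b| ⊗ I) ψ ∈ ℂ^α ⊗ ℂ^γ`, for `ψ ∈ ℂ^α ⊗ ℂ^β ⊗ ℂ^γ` and a standard basis
vector `b` of `ℂ^β`. -/
def sliceB (b : β) (ψ : EuclideanSpace ℂ (α × β × γ)) : EuclideanSpace ℂ (α × γ) :=
  WithLp.toLp 2 fun x => ψ (x.1, b, x.2)

theorem sum_ketBra_sliceC [Fintype γ] [Fintype κ] (e : OrthonormalBasis κ ℂ (EuclideanSpace ℂ γ))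
    (ψ : EuclideanSpace ℂ (α × β × γ)) :
    ∑ k, ketBra (sliceC (e k) ψ) = marginalAB (ketBra ψ) := by
  ext x y
  -- Parseval's identity in `ℂ^γ`.
  have := e.sum_inner_mul_inner (WithLp.toLp 2 fun c => ψ (y.1, y.2, c))
    (WithLp.toLp 2 fun c => ψ (x.1, x.2, c))
  simp only [PiLp.inner_apply, RCLike.inner_apply] at this
  simp only [Matrix.sum_apply, ketBra, sliceC, marginalAB, Matrix.of_apply]
  refine Eq.trans (Finset.sum_congr rfl fun k _ => ?_) this
  rw [mul_comm, star_sum]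
  congr 1
  · refine Finset.sum_congr rfl fun c _ => ?_
    simp
  · refine Finset.sum_congr rfl fun c _ => ?_
    simp [mul_comm]

theorem sum_ketBra_sliceB [Fintype β] (ψ : EuclideanSpace ℂ (α × β × γ)) :
    ∑ b, ketBra (sliceB b ψ) = marginalAC (ketBra ψ) := by
  ext x y
  simp [Matrix.sum_apply, ketBra, sliceB, marginalAC]

theorem isDensity_marginalAB_ketBra [Fintype α] [Fintype β] [Fintype γ] [DecidableEq γ] (ψ : EuclideanSpace ℂ (α × β × γ))
    (hψ : ‖ψ‖ = 1) : IsDensity (marginalAB (ketBra ψ)) := by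
  constructor
  · rw [← sum_ketBra_sliceC (EuclideanSpace.basisFun γ ℂ)]
    exact Matrix.posSemidef_sum _ fun k _ => posSemidef_ketBra _
  · rw [← trace_marginalA, marginalA_marginalAB, trace_marginalA, trace_ketBra, hψ]
    simp

theorem isDensity_marginalAC_ketBra [Fintype α] [Fintype β] [Fintype γ] (ψ : EuclideanSpace ℂ (α × β × γ))
    (hψ : ‖ψ‖ = 1) : IsDensity (marginalAC (ketBra ψ)) := by
  constructor
  · rw [← sum_ketBra_sliceB]
    exact Matrix.posSemidef_sum _ fun k _ => posSemidef_ketBra _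
  · rw [← trace_marginalA, marginalA_marginalAC, trace_marginalA, trace_ketBra, hψ]
    simp

/-! ### The convex roof -/

variable [Fintype α] [Fintype β] [DecidableEq α]

theorem gPure_nonneg (v : EuclideanSpace ℂ (α × β)) : 0 ≤ gPure v :=
  Real.rpow_nonneg (posSemidef_marginalA_ketBra v).det_re_nonneg _

theorem continuous_gPure : Continuous (gPure : EuclideanSpace ℂ (α × β) → ℝ) := by
  have h : Continuous fun v : EuclideanSpace ℂ (α × β) => marginalA (ketBra v) := by
    unfold marginalA ketBra
    fun_prop
  exact (Complex.continuous_re.comp h.matrix_det).rpow_const fun _ => Or.inr (by positivity)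

/-- The `d`-th root cancels the degree `d` of the determinant, so unnormalized vectors carry their
weight inside `gPure`. -/
theorem gPure_smul [Nonempty α] (c : ℂ) (v : EuclideanSpace ℂ (α × β)) :
    gPure (c • v) = ‖c‖ ^ 2 * gPure v := by
  have h : (marginalA (ketBra (c • v))).det.re =
      (‖c‖ ^ 2) ^ Fintype.card α * (marginalA (ketBra v)).det.re := by
    rw [ketBra_smul, marginalA_smul, ← Complex.coe_smul, Matrix.det_smul, ← Complex.ofReal_pow,
      Complex.re_ofReal_mul]
  rw [gPure, h, Real.mul_rpow (by positivity) (posSemidef_marginalA_ketBra v).det_re_nonneg,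
    one_div, Real.pow_rpow_inv_natCast (by positivity) Fintype.card_ne_zero, gPure, one_div]

variable (α β) in
/-- The convex hull of the graph of the G-concurrence on pure states `|φ⟩⟨φ|`. -/
def gGraphHull : Set (Matrix (α × β) (α × β) ℂ × ℝ) :=
  convexHull ℝ ((fun φ => (ketBra φ, gPure φ)) '' Metric.sphere 0 1)

/-- The averages form a fibre of one convex hull, so compactness and convexity of the hull become
attainment and convexity of the roof. -/
theorem mem_gAverages_iff {ρ : Matrix (α × β) (α × β) ℂ} {x : ℝ} :
    x ∈ gAverages ρ ↔ (ρ, x) ∈ gGraphHull α β := by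
  constructor
  · rintro ⟨k, p, ψ, ⟨hp, hs, hψ, rfl⟩, rfl⟩
    refine mem_convexHull_of_exists_fintype p (fun j => (ketBra (ψ j), gPure (ψ j))) hp hs
      (fun j => ⟨ψ j, by simp [hψ], rfl⟩) ?_
    simp only [Prod.smul_mk, smul_eq_mul, Complex.coe_smul]
    exact Prod.ext (Prod.fst_sum ..) (Prod.snd_sum ..)
  · intro h
    obtain ⟨ι, _, w, z, hw, hw1, hz, hx⟩ := mem_convexHull_iff_exists_fintype.1 h
    choose φ hφ hφz using hz
    simp only [mem_sphere_zero_iff_norm] at hφ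
    let e := Fintype.equivFin ι
    refine ⟨_, w ∘ e.symm, φ ∘ e.symm, ⟨fun j => hw _, ?_, fun j => hφ _, ?_⟩, ?_⟩
    · rw [← hw1]
      exact Equiv.sum_comp e.symm w
    · refine Eq.trans ?_ (Equiv.sum_comp e.symm fun i => (w i : ℂ) • ketBra (φ i)).symm
      rw [← show _ = ρ from congrArg Prod.fst hx, Prod.fst_sum]
      refine Finset.sum_congr rfl fun i _ => ?_
      rw [← hφz, Complex.coe_smul]
      rfl
    · refine Eq.trans ?_ (Equiv.sum_comp e.symm fun i => w i * gPure (φ i)).symm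
      rw [← show _ = x from congrArg Prod.snd hx, Prod.snd_sum]
      refine Finset.sum_congr rfl fun i _ => ?_
      rw [← hφz]
      rfl

theorem nonneg_of_mem_gAverages {ρ : Matrix (α × β) (α × β) ℂ} {x : ℝ} (hx : x ∈ gAverages ρ) :
    0 ≤ x := by
  obtain ⟨k, p, ψ, ⟨hp, -⟩, rfl⟩ := hx
  exact Finset.sum_nonneg fun j _ => mul_nonneg (hp j) (gPure_nonneg _)

theorem gConc_nonneg (ρ : Matrix (α × β) (α × β) ℂ) : 0 ≤ gConc ρ :=
  Real.sInf_nonneg fun _ => nonneg_of_mem_gAverages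

theorem gConc_le {ρ : Matrix (α × β) (α × β) ℂ} {x : ℝ} (h : (ρ, x) ∈ gGraphHull α β) :
    gConc ρ ≤ x :=
  csInf_le ⟨0, fun _ => nonneg_of_mem_gAverages⟩ (mem_gAverages_iff.2 h)

/-- The infimum in the convex roof is attained. -/
theorem gConc_mem_gAverages [DecidableEq β] {ρ : Matrix (α × β) (α × β) ℂ} (h : IsDensity ρ) :
    gConc ρ ∈ gAverages ρ := by
  refine IsClosed.csInf_mem ?_ (gAverages_nonempty h) ⟨0, fun _ => nonneg_of_mem_gAverages⟩
  have hK : IsCompact (gGraphHull α β) := isCompact_convexHull_of_finiteDimensional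
    ((isCompact_sphere _ _).image (continuous_ketBra.prodMk continuous_gPure))
  have : gAverages ρ = (fun x => (ρ, x)) ⁻¹' gGraphHull α β :=
    Set.ext fun _ => mem_gAverages_iff
  rw [this]
  exact hK.isClosed.preimage (by fun_prop)

/-- Each point `(ρ k, gConc (ρ k))` lies in the hull because the infimum is attained; hence so does
their average. -/
theorem gConc_sum_smul_le [Fintype κ] [DecidableEq β] {p : κ → ℝ} {ρ : κ → Matrix (α × β) (α × β) ℂ}
    (hp : ∀ k, 0 ≤ p k) (hs : ∑ k, p k = 1) (hρ : ∀ k, IsDensity (ρ k)) :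
    gConc (∑ k, p k • ρ k) ≤ ∑ k, p k * gConc (ρ k) := by
  apply gConc_le
  have := (convex_convexHull ℝ _).sum_mem (t := Finset.univ) (fun k _ => hp k) hs
    fun k _ => mem_gAverages_iff.1 (gConc_mem_gAverages (hρ k))
  rwa [show ∑ k, p k • (ρ k, gConc (ρ k)) = (∑ k, p k • ρ k, ∑ k, p k * gConc (ρ k)) from
    Prod.ext (Prod.fst_sum ..) (Prod.snd_sum ..)] at this

/-- A decomposition into subnormalized vectors bounds the convex roof. -/
theorem gConc_sum_ketBra_le [Fintype κ] [Nonempty α] (v : κ → EuclideanSpace ℂ (α × β))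
    (h : (∑ k, ketBra (v k)).trace = 1) : gConc (∑ k, ketBra (v k)) ≤ ∑ k, gPure (v k) := by
  classical
  apply gConc_le
  -- Normalized vectors, to be weighted by `‖v k‖ ^ 2`. A zero `v k` is not normalizable and is
  -- filtered out; it contributes nothing.
  set z : κ → Matrix (α × β) (α × β) ℂ × ℝ := fun k =>
    (ketBra ((‖v k‖⁻¹ : ℂ) • v k), gPure ((‖v k‖⁻¹ : ℂ) • v k)) with hz
  have hwz : ∀ k, ‖v k‖ ^ 2 • z k = (ketBra (v k), gPure (v k)) := by
    intro k
    by_cases h0 : v k = 0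
    · have h1 := ketBra_smul 0 (v k)
      have h2 := gPure_smul 0 (v k)
      simp only [zero_smul] at h1 h2
      rw [h0, h1, h2]
      simp [Prod.zero_eq_mk]
    · have h1 : ‖v k‖ ≠ 0 := norm_ne_zero_iff.2 h0
      have h2 : ‖v k‖ ^ 2 * ‖(‖v k‖⁻¹ : ℂ)‖ ^ 2 = 1 := by
        rw [norm_inv, Complex.norm_real, norm_norm]
        field_simp
      simp only [hz, Prod.smul_mk, ketBra_smul, gPure_smul, smul_smul, smul_eq_mul, ← mul_assoc,
        h2, one_smul, one_mul]
  have htr : ∑ k, ‖v k‖ ^ 2 = 1 := by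
    rw [Matrix.trace_sum] at h
    simp only [trace_ketBra] at h
    exact_mod_cast h
  have hsub : ∑ k with v k ≠ 0, ‖v k‖ ^ 2 = 1 := by
    rw [← htr]
    refine Finset.sum_filter_of_ne fun k _ hk h0 => hk ?_
    simp [h0]
  have hmem := (convex_convexHull ℝ _).sum_mem (t := Finset.univ.filter fun k => v k ≠ 0)
    (w := fun k => ‖v k‖ ^ 2) (z := z) (fun k _ => by positivity) hsub
    fun k hk => subset_convexHull ℝ
      ((fun φ => (ketBra φ, gPure φ)) '' Metric.sphere 0 1) ⟨(‖v k‖⁻¹ : ℂ) • v k, by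
        have : ‖v k‖ ≠ 0 := norm_ne_zero_iff.2 (Finset.mem_filter.1 hk).2
        rw [mem_sphere_zero_iff_norm, norm_smul, norm_inv, Complex.norm_real, norm_norm,
          inv_mul_cancel₀ this], rfl⟩
  rw [Finset.sum_filter_of_ne] at hmem
  · simp only [hwz] at hmem
    rwa [show ∑ k, (ketBra (v k), gPure (v k)) = (∑ k, ketBra (v k), ∑ k, gPure (v k)) from
      Prod.ext (Prod.fst_sum ..) (Prod.snd_sum ..)] at hmem
  · intro k _ hk h0
    refine hk ?_
    simp [h0]

end Quantum

/-! ### Rigidity under equality, and monogamy -/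

namespace Quantum

variable {α β γ κ : Type*}

theorem sliceC_smul [Fintype γ] (c : ℂ) (e : EuclideanSpace ℂ γ) (ψ : EuclideanSpace ℂ (α × β × γ)) :
    sliceC (c • e) ψ = star c • sliceC e ψ := by
  ext x
  simp [sliceC, Finset.mul_sum, mul_assoc]

theorem sliceC_sub [Fintype γ] (e f : EuclideanSpace ℂ γ) (ψ : EuclideanSpace ℂ (α × β × γ)) :
    sliceC (e - f) ψ = sliceC e ψ - sliceC f ψ := by
  ext x
  simp [sliceC, sub_mul, Finset.sum_sub_distrib]

theorem sum_marginalA_sliceC [Fintype β] [Fintype γ] [Fintype κ] (e : OrthonormalBasis κ ℂ (EuclideanSpace ℂ γ))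
    (ψ : EuclideanSpace ℂ (α × β × γ)) :
    ∑ k, marginalA (ketBra (sliceC (e k) ψ)) = marginalA (ketBra ψ) := by
  rw [← marginalA_sum, sum_ketBra_sliceC, marginalA_marginalAB]

/-- Equal dimensions of A and B enter here: the reduced matrix is `X * Xᴴ` with `X` square. -/
theorem det_marginalA_ketBra_eq_zero_iff [Fintype α] [DecidableEq α] (v : EuclideanSpace ℂ (α × α)) :
    (marginalA (ketBra v)).det = 0 ↔ (Matrix.of fun a b => v (a, b) : Matrix α α ℂ).det = 0 := by
  have h : marginalA (ketBra v) = (Matrix.of fun a b => v (a, b) : Matrix α α ℂ) *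
      (Matrix.of fun a b => v (a, b) : Matrix α α ℂ).conjTranspose := by
    ext a a'
    simp [marginalA, ketBra, Matrix.mul_apply]
  rw [h, Matrix.det_mul, Matrix.det_conjTranspose, mul_eq_zero, star_eq_zero, or_self]

/-- A matrix pencil over `ℂ` whose leading matrix is nonsingular contains a singular matrix. -/
theorem _root_.Matrix.exists_det_sub_smul_eq_zero [Fintype α] [DecidableEq α] [Nonempty α] (X Y : Matrix α α ℂ)
    (hY : Y.det ≠ 0) : ∃ t : ℂ, (X - t • Y).det = 0 := by
  -- `t` is an eigenvalue of `Y⁻¹ * X`.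
  obtain ⟨t, ht⟩ := spectrum.nonempty_of_isAlgClosed_of_finiteDimensional ℂ (Y⁻¹ * X)
  refine ⟨t, ?_⟩
  rw [spectrum.mem_iff, Matrix.isUnit_iff_isUnit_det, isUnit_iff_ne_zero, not_not,
    Algebra.algebraMap_eq_smul_one] at ht
  have h : X - t • Y = -(Y * (t • 1 - Y⁻¹ * X)) := by
    rw [mul_sub, Matrix.mul_nonsing_inv_cancel_left _ _ hY.isUnit]
    simp
  rw [h, Matrix.det_neg, Matrix.det_mul, ht, mul_zero, mul_zero]

variable [Fintype α] [Fintype β] [Fintype γ] [DecidableEq α]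

theorem gConc_marginalAB_le_sum [Fintype κ] [Nonempty α] {ψ : EuclideanSpace ℂ (α × β × γ)}
    (hψ : ‖ψ‖ = 1) (e : OrthonormalBasis κ ℂ (EuclideanSpace ℂ γ)) :
    gConc (marginalAB (ketBra ψ)) ≤ ∑ k, gPure (sliceC (e k) ψ) := by
  classical
  rw [← sum_ketBra_sliceC e]
  apply gConc_sum_ketBra_le
  rw [sum_ketBra_sliceC e, (isDensity_marginalAB_ketBra ψ hψ).2]

/-- Discarding a part of the second factor does not increase the G-concurrence. -/
theorem gConc_marginalAB_le [Nonempty α] [DecidableEq γ] {ψ : EuclideanSpace ℂ (α × β × γ)}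
    (hψ : ‖ψ‖ = 1) : gConc (marginalAB (ketBra ψ)) ≤ gPure ψ := by
  refine (gConc_marginalAB_le_sum hψ (EuclideanSpace.basisFun γ ℂ)).trans ?_
  rw [gPure, ← sum_marginalA_sliceC (EuclideanSpace.basisFun γ ℂ)]
  exact Matrix.sum_det_rpow_le fun _ => posSemidef_marginalA_ketBra _

theorem gConc_marginalAC_le_sum [Nonempty α] {ψ : EuclideanSpace ℂ (α × β × γ)}
    (hψ : ‖ψ‖ = 1) : gConc (marginalAC (ketBra ψ)) ≤ ∑ b, gPure (sliceB b ψ) := by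
  rw [← sum_ketBra_sliceB]
  apply gConc_sum_ketBra_le
  rw [sum_ketBra_sliceB, (isDensity_marginalAC_ketBra ψ hψ).2]

theorem gConc_marginalAC_le [Nonempty α] {ψ : EuclideanSpace ℂ (α × β × γ)}
    (hψ : ‖ψ‖ = 1) : gConc (marginalAC (ketBra ψ)) ≤ gPure ψ := by
  refine (gConc_marginalAC_le_sum hψ).trans ?_
  rw [gPure, ← marginalA_marginalAC, ← sum_ketBra_sliceB, marginalA_sum]
  exact Matrix.sum_det_rpow_le fun _ => posSemidef_marginalA_ketBra _

/-- If the discarded system does not carry any G-concurrence, then no measurement outcome on it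
leaves a nonzero vector with singular reduced matrix. -/
theorem sliceC_eq_zero_of_det_eq_zero [Nonempty α] {ψ : EuclideanSpace ℂ (α × β × γ)}
    (hψ : ‖ψ‖ = 1) (heq : gPure ψ = gConc (marginalAB (ketBra ψ)))
    (hdet : (marginalA (ketBra ψ)).det ≠ 0) (e : EuclideanSpace ℂ γ)
    (he : (marginalA (ketBra (sliceC e ψ))).det = 0) : sliceC e ψ = 0 := by
  by_contra h0
  have he0 : ‖e‖ ≠ 0 := by
    refine norm_ne_zero_iff.2 fun h => h0 ?_
    have := sliceC_smul 0 e ψ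
    rw [h] at this ⊢
    simpa using this
  set c : ℂ := (‖e‖⁻¹ : ℂ) with hc
  have hc0 : c ≠ 0 := by simpa [hc] using he0
  have hu : ‖c • e‖ = 1 := by
    rw [norm_smul, hc, norm_inv, Complex.norm_real, norm_norm, inv_mul_cancel₀ he0]
  -- The normalized `e` is completed to a measurement basis in which it is one of the outcomes.
  have hon : Orthonormal ℂ ((↑) : ({c • e} : Set (EuclideanSpace ℂ γ)) → EuclideanSpace ℂ γ) :=
    ⟨fun i => by rw [i.2]; exact hu, fun i j hij => (hij (Subsingleton.elim i j)).elim⟩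
  obtain ⟨s, b, hs, hb⟩ := hon.exists_orthonormalBasis_extension
  have hk : b ⟨c • e, hs rfl⟩ = c • e := by rw [hb]
  have hlt := Matrix.sum_det_rpow_lt (M := fun k => marginalA (ketBra (sliceC (b k) ψ)))
    (fun _ => posSemidef_marginalA_ketBra _) (by rwa [sum_marginalA_sliceC])
    (k₀ := ⟨c • e, hs rfl⟩) ?_ ?_
  · rw [sum_marginalA_sliceC] at hlt
    exact (hlt.trans_le heq.le).not_ge (gConc_marginalAB_le_sum hψ b)
  · rw [hk, sliceC_smul]
    intro h
    have := congrArg Matrix.trace h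
    rw [trace_marginalA, trace_ketBra, Matrix.trace_zero, norm_smul] at this
    simp [hc0, h0] at this
  · rw [hk, sliceC_smul, ketBra_smul, marginalA_smul, ← Complex.coe_smul, Matrix.det_smul, he,
      mul_zero]

/-- If the G-concurrence of `A|BC` is positive and equal to that of `AB`, then `C` is in a product
state with `AB`. -/
theorem exists_eq_mul_of_gPure_eq [Nonempty α] [DecidableEq γ]
    {ψ : EuclideanSpace ℂ (α × α × γ)} (hψ : ‖ψ‖ = 1)
    (heq : gPure ψ = gConc (marginalAB (ketBra ψ)))
    (hpos : 0 < gConc (marginalAB (ketBra ψ))) :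
    ∃ (χ : EuclideanSpace ℂ (α × α)) (φ : EuclideanSpace ℂ γ),
      ‖χ‖ = 1 ∧ ‖φ‖ = 1 ∧ ∀ a b c, ψ (a, b, c) = χ (a, b) * φ c := by
  have hd : (Fintype.card α : ℝ) ≠ 0 := by exact_mod_cast Fintype.card_ne_zero
  have hdet : (marginalA (ketBra ψ)).det ≠ 0 := by
    intro h
    rw [← heq, gPure, h] at hpos
    simp [hd] at hpos
  have key := sliceC_eq_zero_of_det_eq_zero hψ heq hdet
  set X : γ → EuclideanSpace ℂ (α × α) := fun c => WithLp.toLp 2 fun x => ψ (x.1, x.2, c) with hX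
  have hXs : ∀ c, sliceC (EuclideanSpace.single c 1) ψ = X c := fun c => by
    ext x
    simp [sliceC, hX]
  obtain ⟨c₀, hc₀⟩ : ∃ c, X c ≠ 0 := by
    by_contra! h
    have : ψ = 0 := by
      ext ⟨a, b, c⟩
      exact congrArg (fun v : EuclideanSpace ℂ (α × α) => v (a, b)) (h c)
    simp [this] at hψ
  have hY : (Matrix.of fun a b => X c₀ (a, b) : Matrix α α ℂ).det ≠ 0 := fun h =>
    hc₀ (hXs c₀ ▸ key (EuclideanSpace.single c₀ 1)
      ((det_marginalA_ketBra_eq_zero_iff _).2 (by rwa [hXs])))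
  have hprop : ∀ c, ∃ t : ℂ, X c = t • X c₀ := by
    intro c
    obtain ⟨t, ht⟩ := Matrix.exists_det_sub_smul_eq_zero
      (Matrix.of fun a b => X c (a, b) : Matrix α α ℂ) _ hY
    -- Slicing is conjugate-linear in `e`, whence `star t`.
    have hs : sliceC (EuclideanSpace.single c 1 - star t • EuclideanSpace.single c₀ 1) ψ =
        X c - t • X c₀ := by
      rw [sliceC_sub, sliceC_smul, hXs, hXs, star_star]
    refine ⟨t, sub_eq_zero.1 (hs ▸ key _ ((det_marginalA_ketBra_eq_zero_iff _).2 ?_))⟩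
    rw [hs]
    exact ht
  choose t ht using hprop
  have hn : ‖X c₀‖ ≠ 0 := norm_ne_zero_iff.2 hc₀
  have hχ : ‖(‖X c₀‖⁻¹ : ℂ) • X c₀‖ = 1 := by
    rw [norm_smul, norm_inv, Complex.norm_real, norm_norm, inv_mul_cancel₀ hn]
  have hprod : ∀ a b c, ψ (a, b, c) = ((‖X c₀‖⁻¹ : ℂ) • X c₀) (a, b) *
      (WithLp.toLp 2 fun c => (‖X c₀‖ : ℂ) * t c : EuclideanSpace ℂ γ) c := by
    intro a b c
    have h1 : ψ (a, b, c) = t c * X c₀ (a, b) :=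
      congrArg (fun v : EuclideanSpace ℂ (α × α) => v (a, b)) (ht c)
    have h2 : (‖X c₀‖ : ℂ) ≠ 0 := by exact_mod_cast hn
    rw [h1]
    simp only [PiLp.smul_apply, smul_eq_mul]
    field_simp
  refine ⟨_, _, hχ, ?_, hprod⟩
  have h1 : ‖ψ‖ ^ 2 = ‖(‖X c₀‖⁻¹ : ℂ) • X c₀‖ ^ 2 *
      ‖(WithLp.toLp 2 fun c => (‖X c₀‖ : ℂ) * t c : EuclideanSpace ℂ γ)‖ ^ 2 := by
    rw [EuclideanSpace.norm_sq_eq, EuclideanSpace.norm_sq_eq, EuclideanSpace.norm_sq_eq,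
      Finset.sum_mul_sum, Fintype.sum_prod_type, Fintype.sum_prod_type]
    refine Finset.sum_congr rfl fun a _ => ?_
    rw [Fintype.sum_prod_type]
    refine Finset.sum_congr rfl fun b _ => Finset.sum_congr rfl fun c _ => ?_
    rw [hprod, norm_mul, mul_pow]
  rw [hψ, hχ] at h1
  exact (sq_eq_sq₀ (norm_nonneg _) zero_le_one).1 (by linarith)

theorem gConc_marginalAC_eq_zero_of_eq_mul [Nontrivial α] {ψ : EuclideanSpace ℂ (α × β × γ)}
    (hψ : ‖ψ‖ = 1) {χ : α × β → ℂ} {φ : γ → ℂ} (h : ∀ a b c, ψ (a, b, c) = χ (a, b) * φ c) :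
    gConc (marginalAC (ketBra ψ)) = 0 := by
  have hd : (Fintype.card α : ℝ) ≠ 0 := by exact_mod_cast Fintype.card_ne_zero
  refine le_antisymm ((gConc_marginalAC_le_sum hψ).trans_eq ?_) (gConc_nonneg _)
  refine Finset.sum_eq_zero fun b _ => ?_
  -- The slice along `b` is a product vector, so its reduced matrix has rank at most one and is
  -- singular for `d ≥ 2`.
  have h1 : marginalA (ketBra (sliceB b ψ)) = Matrix.vecMulVec (fun a => χ (a, b))
      fun a => ∑ c, φ c * star (χ (a, b) * φ c) := by
    ext a a'
    simp [marginalA, ketBra, sliceB, h, Matrix.vecMulVec_apply, Finset.mul_sum, mul_assoc]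
  rw [gPure, h1, Matrix.det_vecMulVec, Complex.zero_re, Real.zero_rpow (by positivity)]

/-- The G-concurrence is monogamous on pure states. -/
theorem gConc_marginalAC_ketBra_eq_zero [Nontrivial α] [DecidableEq γ]
    {ψ : EuclideanSpace ℂ (α × α × γ)} (hψ : ‖ψ‖ = 1)
    (heq : gPure ψ = gConc (marginalAB (ketBra ψ))) :
    gConc (marginalAC (ketBra ψ)) = 0 := by
  rcases (gConc_nonneg (marginalAB (ketBra ψ))).eq_or_lt with h0 | hpos
  · exact le_antisymm ((gConc_marginalAC_le hψ).trans_eq (heq.trans h0.symm)) (gConc_nonneg _)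
  · obtain ⟨χ, φ, -, -, h⟩ := exists_eq_mul_of_gPure_eq hψ heq hpos
    exact gConc_marginalAC_eq_zero_of_eq_mul hψ h

/-- The G-concurrence is monogamous on mixed states. -/
theorem gConc_marginalAC_eq_zero [Nontrivial α] [DecidableEq γ]
    {ρ : Matrix (α × α × γ) (α × α × γ) ℂ} (hρ : IsDensity ρ)
    (heq : gConc ρ = gConc (marginalAB ρ)) : gConc (marginalAC ρ) = 0 := by
  obtain ⟨k, p, ψ, ⟨hp, hs, hψ, hd⟩, hx⟩ := gConc_mem_gAverages hρ
  simp only [Complex.coe_smul] at hd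
  have hAB : gConc (marginalAB ρ) ≤ ∑ j, p j * gConc (marginalAB (ketBra (ψ j))) := by
    rw [hd, marginalAB_sum_smul]
    exact gConc_sum_smul_le hp hs fun j => isDensity_marginalAB_ketBra _ (hψ j)
  have hle : ∀ j ∈ Finset.univ, p j * gConc (marginalAB (ketBra (ψ j))) ≤ p j * gPure (ψ j) :=
    fun j _ => mul_le_mul_of_nonneg_left (gConc_marginalAB_le (hψ j)) (hp j)
  -- The decomposition is optimal, so `∑ p j * gPure (ψ j) = gConc ρ = gConc (marginalAB ρ)`, which
  -- `hAB` bounds by the other sum; termwise inequalities then become equalities.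
  have hterm := (Finset.sum_eq_sum_iff_of_le hle).1
    (le_antisymm (Finset.sum_le_sum hle) (hx ▸ heq ▸ hAB))
  refine le_antisymm ?_ (gConc_nonneg _)
  rw [hd, marginalAC_sum_smul]
  refine (gConc_sum_smul_le hp hs fun j => isDensity_marginalAC_ketBra _ (hψ j)).trans_eq ?_
  refine Finset.sum_eq_zero fun j hj => ?_
  rcases eq_or_ne (p j) 0 with h0 | h0
  · rw [h0, zero_mul]
  · rw [gConc_marginalAC_ketBra_eq_zero (hψ j) (mul_left_cancel₀ h0 (hterm j hj)).symm, mul_zero]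

end Quantum

theorem corollary8 (d n : ℕ) :
    (∀ ψ : EuclideanSpace ℂ (Fin d × Fin d × Fin n), ‖ψ‖ = 1 →
      Quantum.gPure ψ = Quantum.gConc (Quantum.marginalAB (Quantum.ketBra ψ)) →
      0 < Quantum.gConc (Quantum.marginalAB (Quantum.ketBra ψ)) →
      ∃ (χ : EuclideanSpace ℂ (Fin d × Fin d)) (φ : EuclideanSpace ℂ (Fin n)),
        ‖χ‖ = 1 ∧ ‖φ‖ = 1 ∧ ∀ a b c, ψ (a, b, c) = χ (a, b) * φ c) ∧
    (2 ≤ d →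
      (∀ ψ : EuclideanSpace ℂ (Fin d × Fin d × Fin n), ‖ψ‖ = 1 →
        Quantum.gPure ψ = Quantum.gConc (Quantum.marginalAB (Quantum.ketBra ψ)) →
        Quantum.gConc (Quantum.marginalAC (Quantum.ketBra ψ)) = 0) ∧
      (∀ ρ : Matrix (Fin d × Fin d × Fin n) (Fin d × Fin d × Fin n) ℂ, Quantum.IsDensity ρ →
        Quantum.gConc ρ = Quantum.gConc (Quantum.marginalAB ρ) →
        Quantum.gConc (Quantum.marginalAC ρ) = 0)) := by
  refine ⟨fun ψ hψ heq hpos => ?_, fun hd => ?_⟩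
  -- A unit vector rules out `d = 0` and `n = 0`.
  · obtain ⟨i⟩ : Nonempty (Fin d × Fin d × Fin n) := by
      by_contra! h
      simp [Subsingleton.elim ψ 0] at hψ
    have : Nonempty (Fin d) := ⟨i.1⟩
    exact Quantum.exists_eq_mul_of_gPure_eq hψ heq hpos
  · have : Nontrivial (Fin d) := Fin.nontrivial_iff_two_le.2 hd
    exact ⟨fun ψ hψ heq => Quantum.gConc_marginalAC_ketBra_eq_zero hψ heq,
      fun ρ hρ heq => Quantum.gConc_marginalAC_eq_zero hρ heq⟩
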